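/- Let $(M,c)$ be a smooth manifold of dimension $d\ge 3$ (possibly with boundary) with a conformal class $c$ of smooth pseudo-Riemannian metrics of any signature; for $g\in c$ the class consists of the metrics $e^{2\Upsilon}g$, $\Upsilon\in C^\infty(M)$. Let $\mathcal E[w]$, $w\in\mathbb C$, be the (complex) conformal density bundles (in the scale $g$ a density is a function $f_g$, with $f_{e^{2\Upsilon}g}=e^{w\Upsilon}f_g$), let $\mathcal T\stackrel{g}{\cong}\mathcal E[1]\oplus T^*M[1]\oplus\mathcal E[-1]$ be the standard tractor bundle, with change of splitting $$\widehat{(s,\mu_a,\rho)}=\bigl(s,\ \mu_a+s\Upsilon_a,\ \rho-\Upsilon^a\mu_a-\tfrac12 s\,\Upsilon^a\Upsilon_a\bigr),\qquad \Upsilon_a=\nabla_a\Upsilon,$$ tractor metric $h(T,T)=\mu^a\mu_a+2s\rho$, used to raise and lower tractor indices $A$, and tractor connection $$\nabla_a(s,\mu_b,\rho)=(\nabla_a s-\mu_a,\ \nabla_a\mu_b+g_{ab}\rho+P_{ab}s,\ \nabla_a\rho-P_{ab}\mu^b),$$ where $P_{ab}$ is the Schouten tensor, $\mathrm{Ric}_{ab}=(d-2)P_{ab}+Jg_{ab}$,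 $J=P^a{}_a$. Let $\mathbf w$ be the weight operator, induced by the Euler operator $t\,\partial_t$ of the bundle of metrics $t^2g$ (tractor indices being of weight $0$): it is multiplication by $w$ on sections of $\mathcal E^\Phi[w]=\mathcal E^\Phi\otimes\mathcal E[w]$, for any tractor bundle $\mathcal E^\Phi$ (a tensor power of $\mathcal T$ or a tensor part of one), it obeys the Leibniz rule for products with densities and log densities, and $\mathbf w\log\sigma=1$ for $0<\sigma\in\Gamma\mathcal E[1]$, so that $\mathbf w(\log\sigma\, f)=w\log\sigma\, f+f$ for $f\in\Gamma\mathcal E^\Phi[w]$. Let $D_A$ be the Thomas-D operator, in a scale $g\in c$ $$D_AV=\bigl((d+2\mathbf w-2)\mathbf wV,\ (d+2\mathbf w-2)\nabla_aV,\ -(\Delta+J\mathbf w)V\bigr),\qquad \Delta=g^{ab}\nabla_a\nabla_b ,$$ with $\nabla$ the coupled Levi-Civita-tractor connection. Let $\sigma$ be a smooth real section of $\mathcal E[1]$, let $I_A=\frac1d D_A\sigma$ be its scale tractor, $I^2=I^AI_A$ and $I\cdot D=I^AD_A$, and suppose that $I^2$ is nowhere vanishing on $M$. Put $x=\sigma$,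 $y=-\frac1{I^2}\,I\cdot D$ and $h=d+2\mathbf w$. Then, on every open set $U\subseteq M$ on which $\sigma>0$, and for every tractor bundle $\mathcal E^\Phi$, every $w\in\mathbb C$ and every smooth section $f$ of $\mathcal E^\Phi[w]$ over $U$, $$[y,\log x]\,f=-x^{-1}(h-1)f ,$$ that is, $y(\log\sigma\, f)-\log\sigma\; y f=-(d+2w-1)\,\sigma^{-1}f$ on $U$. -/

import Mathlib

open scoped Manifold ContDiff Topology

noncomputable section

namespace ConformalTractor

/-! ### Linear algebra of the fibres -/

/-- The model space of a `d`-dimensional manifold. -/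
abbrev Coord (d : ℕ) : Type := EuclideanSpace ℝ (Fin d)

/-- The `i`-th coordinate vector. -/
def coordVec {d : ℕ} (i : Fin d) : Coord d := EuclideanSpace.single i 1

/-- The fibre of the dual `𝓔[-1] ⊕ TM[-1] ⊕ 𝓔[1]` of the standard tractor bundle
`𝓣 = 𝓔[1] ⊕ T*M[1] ⊕ 𝓔[-1]`, in the splitting given by a metric `g` of the conformal class and with
densities trivialised by `g`. A dual tractor `(a, v, b)` pairs with a tractor `(s, μ, ρ)` to
`a s + μ(v) + b ρ`. (In Mathlib the tangent space at every point is a copy of the model space.) -/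
abbrev DualTractor (d : ℕ) : Type := ℝ × Coord d × ℝ

/-- The fibre of the (complexified) tensor power `⊗ᵏ 𝓣`, as `k`-linear forms on dual tractors. -/
abbrev TractorTensor (d k : ℕ) : Type := DualTractor d [×k]→L[ℝ] ℂ

/-- The three slots of an element of `𝓣 ⊗ W ≅ W ⊕ (T*M ⊗ W) ⊕ W` in a scale; the middle slot is
given by its components. -/
structure Slots (d : ℕ) (W : Type*) where
  top : W
  mid : Fin d → W
  bot : W

/-- Tensorial action on `⊗ᵏ 𝓣` of an endomorphism of `𝓣`, given through its transpose `B`: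
`(α₁, …, αₖ) ↦ ∑ⱼ V(α₁, …, B αⱼ, …, αₖ)`. -/
def tensorAct {d k : ℕ} (B : DualTractor d →L[ℝ] DualTractor d) (V : TractorTensor d k) :
    TractorTensor d k :=
  ∑ j : Fin k, V.compContinuousLinearMap
    (Function.update (fun _ => ContinuousLinearMap.id ℝ (DualTractor d)) j B)

/-! ### Pseudo-Riemannian geometry and the tractor connection in coordinates

`S` is the coordinate domain (a relatively open subset of a half space or of the whole space) and
`G` the matrix of components of the metric. -/

section Coordinates

variable {d : ℕ} (S : Set (Coord d)) (G : Coord d → Matrix (Fin d) (Fin d) ℝ)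

/-- The partial derivative `∂ᵢ u`. -/
def pd {F : Type*} [NormedAddCommGroup F] [NormedSpace ℝ F] (u : Coord d → F) (i : Fin d)
    (x : Coord d) : F :=
  fderivWithin ℝ u S x (coordVec i)

/-- The Christoffel symbol `Γᵏᵢⱼ` of the Levi-Civita connection. -/
def christoffel (k i j : Fin d) (x : Coord d) : ℝ :=
  (1 / 2) * ∑ l, (G x)⁻¹ k l *
    (pd S (fun z => G z j l) i x + pd S (fun z => G z i l) j x - pd S (fun z => G z i j) l x)

/-- The curvature `Rᵢⱼᵏₗ`, that is `R(∂ᵢ, ∂ⱼ) ∂ₗ = Rᵢⱼᵏₗ ∂ₖ` for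
`R(X,Y)Z = ∇_X ∇_Y Z - ∇_Y ∇_X Z - ∇_[X,Y] Z`. -/
def riemann (i j k l : Fin d) (x : Coord d) : ℝ :=
  pd S (christoffel S G k j l) i x - pd S (christoffel S G k i l) j x
    + ∑ m, (christoffel S G k i m x * christoffel S G m j l x
      - christoffel S G k j m x * christoffel S G m i l x)

/-- The Ricci tensor `Ricᵢⱼ = Rₖᵢᵏⱼ`. -/
def ricci (i j : Fin d) (x : Coord d) : ℝ := ∑ k, riemann S G k i k j x

/-- The trace `J` of the Schouten tensor, `J = Sc / (2 (d - 1))`. -/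
def schoutenTrace (x : Coord d) : ℝ :=
  (∑ i, ∑ j, (G x)⁻¹ i j * ricci S G i j x) / (2 * ((d : ℝ) - 1))

/-- The Schouten tensor `P`, given by `Ric = (d - 2) P + J g`. -/
def schouten (i j : Fin d) (x : Coord d) : ℝ :=
  (ricci S G i j x - schoutenTrace S G x * G x i j) / ((d : ℝ) - 2)

/-- The connection form of the tractor connection in the direction `∂ᵢ`, transposed to an
endomorphism of the dual tractor fibre. On a tractor `T = (s, μ, ρ)` it gives
`(T ∘ B)(a, v, b) = a (-μᵢ) + vʲ (-Γᵏᵢⱼ μₖ + gᵢⱼ ρ + Pᵢⱼ s) + b (-Pᵢⱼ gʲᵏ μₖ)`, so `∂ᵢ T + T ∘ B` is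
`(∇ᵢ s - μᵢ, ∇ᵢ μⱼ + gᵢⱼ ρ + Pᵢⱼ s, ∇ᵢ ρ - Pᵢⱼ μʲ)`. -/
def tractorForm (i : Fin d) (x : Coord d) : DualTractor d →L[ℝ] DualTractor d :=
  LinearMap.toContinuousLinearMap
    { toFun := fun α =>
        (∑ j, schouten S G i j x * α.2.1 j,
          - α.1 • coordVec i
            - ∑ k, (∑ j, christoffel S G k i j x * α.2.1 j) • coordVec k
            - α.2.2 • ∑ k, (∑ j, schouten S G i j x * (G x)⁻¹ j k) • coordVec k,
          ∑ j, G x i j * α.2.1 j)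
      map_add' := by
        intro α β
        refine Prod.ext ?_ (Prod.ext ?_ ?_)
        · simp [mul_add, Finset.sum_add_distrib]
        · simp only [Prod.snd_add, Prod.fst_add, PiLp.add_apply, mul_add, Finset.sum_add_distrib,
            add_smul, neg_add]
          abel
        · simp [mul_add, Finset.sum_add_distrib]
      map_smul' := by
        intro r α
        refine Prod.ext ?_ (Prod.ext ?_ ?_)
        · simp [Finset.mul_sum, mul_left_comm]
        · simp only [Prod.smul_snd, Prod.smul_fst, PiLp.smul_apply, smul_eq_mul,
            mul_left_comm _ r, ← Finset.mul_sum, mul_smul, smul_sub, Finset.smul_sum,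
            RingHom.id_apply, neg_smul, smul_neg]
        · simp [Finset.mul_sum, mul_left_comm] }

/-- The covariant derivative `∇ᵢ V` of a section of `⊗ᵏ 𝓣 ⊗ 𝓔[w]`, the densities being trivialised
by the metric. -/
def nabla {k : ℕ} (V : Coord d → TractorTensor d k) (i : Fin d) (x : Coord d) : TractorTensor d k :=
  pd S V i x + tensorAct (tractorForm S G i x) (V x)

/-- The Laplacian `Δ V = gⁱʲ ∇ᵢ ∇ⱼ V` of the coupled Levi-Civita-tractor connection. -/
def laplacian {k : ℕ} (V : Coord d → TractorTensor d k) (x : Coord d) : TractorTensor d k :=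
  ∑ i, ∑ j, (G x)⁻¹ i j •
    (nabla S G (nabla S G V j) i x - ∑ m, christoffel S G m i j x • nabla S G V m x)

end Coordinates

/-! ### Metrics, conformal classes and weighted tractors on a manifold -/

variable {d : ℕ} {H : Type*} [TopologicalSpace H] (I : ModelWithCorners ℝ (Coord d) H)
  (M : Type*) [TopologicalSpace M] [ChartedSpace H M] [IsManifold I ∞ M]

variable {M} in
/-- The derivative at `q` of the change from the preferred chart at `p` to the one at `q`. It sends
the components of a tangent vector at `q` in the chart at `p` to the vector itself. -/
def fromChart (p q : M) : Coord d →L[ℝ] TangentSpace I q := tangentCoordChange I p q q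

variable {M} in
/-- The components, in the preferred chart at `p`, of a field of bilinear forms. -/
def chartMatrix (b : ∀ q : M, TangentSpace I q →L[ℝ] TangentSpace I q →L[ℝ] ℝ) (p : M)
    (x : Coord d) : Matrix (Fin d) (Fin d) ℝ :=
  Matrix.of fun i j =>
    b ((extChartAt I p).symm x)
      (fromChart I p ((extChartAt I p).symm x) (coordVec i))
      (fromChart I p ((extChartAt I p).symm x) (coordVec j))

variable {M} in
/-- The expression, in the preferred chart at `p`, of a field with values in `⊗ᵏ 𝓣` (in a scale). -/
def chartField {k : ℕ} (v : M → TractorTensor d k) (p : M) (x : Coord d) : TractorTensor d k :=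
  (v ((extChartAt I p).symm x)).compContinuousLinearMap fun _ =>
    (ContinuousLinearMap.id ℝ ℝ).prodMap
      (ContinuousLinearMap.prodMap (fromChart I p ((extChartAt I p).symm x))
        (ContinuousLinearMap.id ℝ ℝ))

/-- A smooth pseudo-Riemannian metric, of any signature. -/
@[ext]
structure PseudoMetric where
  val : ∀ p : M, TangentSpace I p →L[ℝ] TangentSpace I p →L[ℝ] ℝ
  symm : ∀ p u v, val p u v = val p v u
  nondegenerate : ∀ p u, (∀ v, val p u v = 0) → u = 0
  smooth : ∀ p i j, ContDiffOn ℝ ∞ (fun x => chartMatrix I val p x i j) (extChartAt I p).target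

variable {I M}

namespace PseudoMetric

/-- The conformally related metric `e^{2Υ} g`. -/
def rescale (g : PseudoMetric I M) (Υ : C^∞⟮I, M; 𝓘(ℝ), ℝ⟯) : PseudoMetric I M where
  val p := Real.exp (2 * Υ p) • g.val p
  symm p u v := by simp [g.symm p u v]
  nondegenerate p u h := by
    refine g.nondegenerate p u fun v => ?_
    have := h v
    simpa [Real.exp_ne_zero] using this
  smooth p i j := by
    have h1 : ContDiffOn ℝ ∞ (fun x => Υ ((extChartAt I p).symm x)) (extChartAt I p).target := by
      rw [← contMDiffOn_iff_contDiffOn]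
      exact Υ.contMDiff.comp_contMDiffOn (contMDiffOn_extChartAt_symm p)
    exact ((contDiffOn_const.mul h1).exp).mul (g.smooth p i j)

/-- The conformal class `c = [g]`. -/
def conformalClass (g : PseudoMetric I M) : Set (PseudoMetric I M) :=
  {g' | ∃ Υ : C^∞⟮I, M; 𝓘(ℝ), ℝ⟯, g' = g.rescale Υ}

/-- The matrix of components of the metric at `p`. -/
def gram (g : PseudoMetric I M) (p : M) : Matrix (Fin d) (Fin d) ℝ :=
  Matrix.of fun i j => g.val p (coordVec i : Coord d) (coordVec j : Coord d)

/-- The differential `dΥ` at `p`. -/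
def differential (Υ : C^∞⟮I, M; 𝓘(ℝ), ℝ⟯) (p : M) : Coord d →L[ℝ] ℝ := mfderiv I 𝓘(ℝ) Υ p

/-- The gradient `g^{ab} Υ_a` at `p`. -/
def gradient (g : PseudoMetric I M) (Υ : C^∞⟮I, M; 𝓘(ℝ), ℝ⟯) (p : M) : Coord d :=
  ∑ i, ∑ j, ((g.gram p)⁻¹ i j * differential Υ p (coordVec i)) • coordVec j

/-- The change of splitting from `g` to `e^{2Υ} g`, transposed to a map of dual tractors (from the
splitting of `e^{2Υ} g` to that of `g`). With the densities trivialised by the respective metric,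
it is the transpose of
`(s, μ, ρ) ↦ (e^Υ s, e^Υ (μ + s dΥ), e^{-Υ} (ρ - g⁻¹(dΥ, μ) - s g⁻¹(dΥ, dΥ) / 2))`. -/
def dualChange (g : PseudoMetric I M) (Υ : C^∞⟮I, M; 𝓘(ℝ), ℝ⟯) (p : M) :
    DualTractor d →L[ℝ] DualTractor d :=
  let dΥ : Coord d →L[ℝ] ℝ := differential Υ p
  let n : Coord d := g.gradient Υ p
  LinearMap.toContinuousLinearMap
    { toFun := fun α =>
        (Real.exp (Υ p) * (α.1 + dΥ α.2.1) - Real.exp (-Υ p) * α.2.2 * dΥ n / 2,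
          Real.exp (Υ p) • α.2.1 - (Real.exp (-Υ p) * α.2.2) • n,
          Real.exp (-Υ p) * α.2.2)
      map_add' := by
        intro α β
        refine Prod.ext ?_ (Prod.ext ?_ ?_)
        · simp only [Prod.fst_add, Prod.snd_add, map_add]; ring
        · simp only [Prod.fst_add, Prod.snd_add, mul_add, add_smul, smul_add]; abel
        · simp only [Prod.snd_add]; ring
      map_smul' := by
        intro r α
        refine Prod.ext ?_ (Prod.ext ?_ ?_)
        · simp only [Prod.smul_fst, Prod.smul_snd, map_smul, smul_eq_mul, RingHom.id_apply]; ring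
        · simp only [Prod.smul_fst, Prod.smul_snd, smul_eq_mul, RingHom.id_apply, smul_sub,
            smul_smul]
          congr 2 <;> ring
        · simp only [Prod.smul_snd, smul_eq_mul, RingHom.id_apply]; ring }

/-- The induced change of splitting of `⊗ᵏ 𝓣`, from `g` to `e^{2Υ} g`. -/
def changeSplitting {k : ℕ} (g : PseudoMetric I M) (Υ : C^∞⟮I, M; 𝓘(ℝ), ℝ⟯) (p : M)
    (t : TractorTensor d k) : TractorTensor d k :=
  t.compContinuousLinearMap fun _ => g.dualChange Υ p

end PseudoMetric

variable (I M) in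
/-- A tractor-valued function on the bundle of conformally related metrics, as the family of its
expressions in the scales `g`. Weighted tractors and their products with log densities are
particular such families; all operators act on families. -/
abbrev Family (k : ℕ) : Type _ := PseudoMetric I M → M → TractorTensor d k

variable (I M) in
/-- A real-valued function on the bundle of conformally related metrics. -/
abbrev RealFamily : Type _ := PseudoMetric I M → M → ℝ

/-- `σ` is a smooth real section over `M` of the density bundle `𝓔[1]` of the conformal
structure `c`. -/
structure IsScale (c : Set (PseudoMetric I M)) (σ : RealFamily I M) : Prop where
  smooth : ∀ g ∈ c, ContMDiff I 𝓘(ℝ) ∞ (σ g)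
  equivariant : ∀ g ∈ c, ∀ (Υ : C^∞⟮I, M; 𝓘(ℝ), ℝ⟯) (p : M),
    σ (g.rescale Υ) p = Real.exp (Υ p) * σ g p

/-- `f` is a smooth section over `U` of the weighted tractor bundle `⊗ᵏ 𝓣 ⊗ 𝓔[w]` of the conformal
structure `c`. -/
structure IsWeightedTractor {k : ℕ} (c : Set (PseudoMetric I M)) (w : ℂ) (U : Set M)
    (f : Family I M k) : Prop where
  smooth : ∀ g ∈ c, ∀ p : M, ContDiffOn ℝ ∞ (chartField I (f g) p)
    ((extChartAt I p).target ∩ (extChartAt I p).symm ⁻¹' U)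
  equivariant : ∀ g ∈ c, ∀ (Υ : C^∞⟮I, M; 𝓘(ℝ), ℝ⟯), ∀ p ∈ U,
    f (g.rescale Υ) p = Complex.exp (w * Υ p) • g.changeSplitting Υ p (f g p)

/-! ### Operators -/

variable {k : ℕ}

/-- The weight operator: the Euler operator of the bundle of conformally related metrics, which is
the derivative at `s = 0` along `s ↦ e^{2s} g`, with the values of the family brought back to the
splitting of `g`. -/
def weightOp (V : Family I M k) : Family I M k := fun g p =>
  deriv (fun s : ℝ =>
    (g.rescale (ContMDiffMap.const s)).changeSplitting (ContMDiffMap.const (-s)) p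
      (V (g.rescale (ContMDiffMap.const s)) p)) 0

/-- The coupled covariant derivative `∇ᵢ V` in the scale `g`, at `p`. -/
def covDeriv (V : Family I M k) (g : PseudoMetric I M) (p : M) (i : Fin d) : TractorTensor d k :=
  nabla (extChartAt I p).target (chartMatrix I g.val p) (chartField I (V g) p) i (extChartAt I p p)

/-- The coupled Laplacian `Δ V` in the scale `g`. -/
def boxOp (V : Family I M k) : Family I M k := fun g p =>
  laplacian (extChartAt I p).target (chartMatrix I g.val p) (chartField I (V g) p) (extChartAt I p p)

/-- The trace `J` of the Schouten tensor, as a function of the scale `g`. -/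
def traceJ : RealFamily I M := fun g p =>
  schoutenTrace (extChartAt I p).target (chartMatrix I g.val p) (extChartAt I p p)

/-- The operator `h = d + 2 𝐰`. -/
def hOp (V : Family I M k) : Family I M k := (d : ℂ) • V + (2 : ℂ) • weightOp V

/-- The Thomas-D operator
`D_A V = ((d + 2𝐰 - 2) 𝐰 V, (d + 2𝐰 - 2) ∇ V, -(Δ + J 𝐰) V)` in the scale `g`, at `p`. -/
def thomasD (V : Family I M k) (g : PseudoMetric I M) (p : M) : Slots d (TractorTensor d k) where
  top := (hOp (weightOp V) - (2 : ℂ) • weightOp V) g p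
  mid := covDeriv (hOp V - (2 : ℂ) • V) g p
  bot := -(boxOp V g p + traceJ g p • weightOp V g p)

/-- A real density as a family of tractors of rank `0`. -/
def toFamily (σ : RealFamily I M) : Family I M 0 := fun g p =>
  ContinuousMultilinearMap.constOfIsEmpty ℝ (fun _ => DualTractor d) ((σ g p : ℝ) : ℂ)

/-- The scale tractor `I_A = (1/d) D_A σ` in the scale `g`, at `p`. -/
def scaleTractor (σ : RealFamily I M) (g : PseudoMetric I M) (p : M) : Slots d ℂ where
  top := (1 / (d : ℂ)) * (thomasD (toFamily σ) g p).top 0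
  mid i := (1 / (d : ℂ)) * (thomasD (toFamily σ) g p).mid i 0
  bot := (1 / (d : ℂ)) * (thomasD (toFamily σ) g p).bot 0

/-- Contraction `T^A T'_A` with the tractor metric
`h(T, T') = g⁻¹(μ, μ') + s ρ' + ρ s'` in the scale `g`, at `p`. -/
def contract {W : Type*} [AddCommGroup W] [Module ℂ W] (g : PseudoMetric I M) (p : M)
    (T : Slots d ℂ) (T' : Slots d W) : W :=
  (∑ i, ∑ j, (((g.gram p)⁻¹ i j : ℝ) : ℂ) • T.mid i • T'.mid j)
    + T.top • T'.bot + T.bot • T'.top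

/-- `I² = I^A I_A`. -/
def scaleSq (σ : RealFamily I M) (g : PseudoMetric I M) (p : M) : ℂ :=
  contract g p (scaleTractor σ g p) (scaleTractor σ g p)

/-- `I·D = I^A D_A`. -/
def iDotD (σ : RealFamily I M) (V : Family I M k) : Family I M k := fun g p =>
  contract g p (scaleTractor σ g p) (thomasD V g p)

/-- The operator `y = -(1/I²) I·D`. -/
def yOp (σ : RealFamily I M) (V : Family I M k) : Family I M k := fun g p =>
  -(1 / scaleSq σ g p) • iDotD σ V g p

/-- Multiplication by the log density `log x`, where `x = σ > 0`. -/
def logXOp (σ : RealFamily I M) (V : Family I M k) : Family I M k := fun g p =>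
  Real.log (σ g p) • V g p

/-- Multiplication by `x⁻¹`, where `x = σ ≠ 0`. -/
def xInvOp (σ : RealFamily I M) (V : Family I M k) : Family I M k := fun g p =>
  (σ g p)⁻¹ • V g p

/-- The commutator of two operators on families. -/
def commutator (A B : Family I M k → Family I M k) (V : Family I M k) : Family I M k :=
  A (B V) - B (A V)

end ConformalTractor

end


/-!
The function `log σ` is a log density with `𝐰 log σ = 1`, so `D_A (log σ f)` differs from
`log σ D_A f` by terms produced by the Leibniz rules for `𝐰`, `∇` and `Δ`. After contraction with
`I_A` the first derivatives of `f` cancel: the middle slot contributes `2 ⟨dσ, ∇f⟩`, and `σ` times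
the bottom slot contributes `-2 σ ⟨d log σ, ∇f⟩`. What is left is `f` times
`σ⁻¹ (d + 2w - 1) (|dσ|² - (2/d) σ (Δσ + J σ))`, and the last factor is `I²`.
-/

open scoped Manifold ContDiff Topology

noncomputable section

namespace ConformalTractor

/-! ### Smoothness of the tractor connection in coordinates -/

section Smoothness

variable {E ι : Type*} [NormedAddCommGroup E] [NormedSpace ℝ E] [Fintype ι] [DecidableEq ι]

lemma contDiffOn_det {n : WithTop ℕ∞} {A : E → Matrix ι ι ℝ} {S : Set E}
    (hA : ∀ i j, ContDiffOn ℝ n (fun x => A x i j) S) :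
    ContDiffOn ℝ n (fun x => (A x).det) S := by
  simp only [Matrix.det_apply, Units.smul_def, zsmul_eq_mul]
  exact ContDiffOn.sum fun τ _ => contDiffOn_const.mul (contDiffOn_prod fun i _ => hA _ _)

lemma contDiffOn_inv_apply {n : WithTop ℕ∞} {A : E → Matrix ι ι ℝ} {S : Set E}
    (hA : ∀ i j, ContDiffOn ℝ n (fun x => A x i j) S) (hdet : ∀ x ∈ S, (A x).det ≠ 0) (i j : ι) :
    ContDiffOn ℝ n (fun x => (A x)⁻¹ i j) S := by
  simp only [Matrix.inv_def, Matrix.smul_apply, Ring.inverse_eq_inv', smul_eq_mul,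
    Matrix.adjugate_apply]
  refine ((contDiffOn_det hA).inv hdet).mul (contDiffOn_det fun a b => ?_)
  by_cases h : a = j
  · subst h
    simpa using contDiffOn_const
  · simpa [Matrix.updateRow_ne h] using hA a b

variable {d : ℕ} {S : Set (Coord d)} {G : Coord d → Matrix (Fin d) (Fin d) ℝ}

lemma contDiffWithinAt_pd {F : Type*} [NormedAddCommGroup F] [NormedSpace ℝ F]
    {m n : WithTop ℕ∞} {u : Coord d → F} {x : Coord d} (hS : UniqueDiffOn ℝ S) (hx : x ∈ S)
    (hu : ContDiffWithinAt ℝ n u S x) (hmn : m + 1 ≤ n) (i : Fin d) :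
    ContDiffWithinAt ℝ m (pd S u i) S x :=
  hu.fderivWithin_right_apply contDiffWithinAt_const hS hmn hx

lemma contDiffOn_pd {F : Type*} [NormedAddCommGroup F] [NormedSpace ℝ F] {u : Coord d → F}
    (hS : UniqueDiffOn ℝ S) (hu : ContDiffOn ℝ ∞ u S) (i : Fin d) :
    ContDiffOn ℝ ∞ (pd S u i) S :=
  fun x hx => contDiffWithinAt_pd hS hx (hu x hx) le_rfl i

variable (hS : UniqueDiffOn ℝ S) (hG : ∀ i j, ContDiffOn ℝ ∞ (fun x => G x i j) S)
  (hdet : ∀ x ∈ S, (G x).det ≠ 0)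
include hS hG hdet

lemma contDiffOn_christoffel (k i j : Fin d) : ContDiffOn ℝ ∞ (christoffel S G k i j) S :=
  contDiffOn_const.mul <| ContDiffOn.sum fun l _ => (contDiffOn_inv_apply hG hdet k l).mul <|
    ((contDiffOn_pd hS (hG j l) i).add (contDiffOn_pd hS (hG i l) j)).sub
      (contDiffOn_pd hS (hG i j) l)

lemma contDiffOn_riemann (i j k l : Fin d) : ContDiffOn ℝ ∞ (riemann S G i j k l) S :=
  have hΓ := contDiffOn_christoffel hS hG hdet
  ((contDiffOn_pd hS (hΓ k j l) i).sub (contDiffOn_pd hS (hΓ k i l) j)).add <|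
    ContDiffOn.sum fun m _ => ((hΓ k i m).mul (hΓ m j l)).sub ((hΓ k j m).mul (hΓ m i l))

lemma contDiffOn_ricci (i j : Fin d) : ContDiffOn ℝ ∞ (ricci S G i j) S :=
  ContDiffOn.sum fun k _ => contDiffOn_riemann hS hG hdet k i k j

lemma contDiffOn_schoutenTrace : ContDiffOn ℝ ∞ (schoutenTrace S G) S :=
  (ContDiffOn.sum fun i _ => ContDiffOn.sum fun j _ =>
    (contDiffOn_inv_apply hG hdet i j).mul (contDiffOn_ricci hS hG hdet i j)).div_const _

lemma contDiffOn_schouten (i j : Fin d) : ContDiffOn ℝ ∞ (schouten S G i j) S :=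
  ((contDiffOn_ricci hS hG hdet i j).sub
    ((contDiffOn_schoutenTrace hS hG hdet).mul (hG i j))).div_const _

lemma contDiffOn_tractorForm (i : Fin d) : ContDiffOn ℝ ∞ (tractorForm S G i) S := by
  have hP := contDiffOn_schouten hS hG hdet
  have hΓ := contDiffOn_christoffel hS hG hdet
  have hinv := contDiffOn_inv_apply hG hdet
  refine contDiffOn_clm_apply.2 fun α => ContDiffOn.prodMk ?_ (ContDiffOn.prodMk ?_ ?_)
  · exact ContDiffOn.sum fun j _ => (hP i j).mul contDiffOn_const
  · refine (contDiffOn_const.sub ?_).sub (ContDiffOn.const_smul α.2.2 ?_)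
    · exact ContDiffOn.sum fun k _ => ContDiffOn.smul
        (ContDiffOn.sum fun j _ => (hΓ k i j).mul contDiffOn_const) contDiffOn_const
    · exact ContDiffOn.sum fun k _ => ContDiffOn.smul
        (ContDiffOn.sum fun j _ => (hP i j).mul (hinv j k)) contDiffOn_const
  · exact ContDiffOn.sum fun j _ => (hG i j).mul contDiffOn_const

end Smoothness

/-! ### Leibniz rules in coordinates -/

section Coordinates

variable {d k : ℕ}

lemma tensorAct_add (B : DualTractor d →L[ℝ] DualTractor d) (V W : TractorTensor d k) :
    tensorAct B (V + W) = tensorAct B V + tensorAct B W := by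
  ext
  simp [tensorAct, Finset.sum_add_distrib]

lemma tensorAct_smul {R : Type*} [Semiring R] [Module R ℂ] [SMulCommClass ℝ R ℂ]
    [ContinuousConstSMul R ℂ] (B : DualTractor d →L[ℝ] DualTractor d) (r : R)
    (V : TractorTensor d k) : tensorAct B (r • V) = r • tensorAct B V := by
  ext
  simp [tensorAct, Finset.smul_sum]

lemma tensorAct_rank_zero (B : DualTractor d →L[ℝ] DualTractor d) (V : TractorTensor d 0) :
    tensorAct B V = 0 :=
  Finset.sum_empty

lemma differentiableWithinAt_tensorAct {E : Type*} [NormedAddCommGroup E] [NormedSpace ℝ E]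
    {S : Set E} {x : E} {B : E → DualTractor d →L[ℝ] DualTractor d} {V : E → TractorTensor d k}
    (hB : DifferentiableWithinAt ℝ B S x) (hV : DifferentiableWithinAt ℝ V S x) :
    DifferentiableWithinAt ℝ (fun z => tensorAct (B z) (V z)) S x := by
  refine DifferentiableWithinAt.fun_sum fun j _ =>
    hV.continuousMultilinearMapCompContinuousLinearMap (g := fun l z =>
      Function.update (fun _ => ContinuousLinearMap.id ℝ (DualTractor d)) j (B z) l) fun l => ?_
  obtain rfl | h := eq_or_ne l j
  · simpa using hB
  · simpa [Function.update_of_ne h] using differentiableWithinAt_const _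

variable {S : Set (Coord d)} {G : Coord d → Matrix (Fin d) (Fin d) ℝ} {x : Coord d}

section pd

variable {F : Type*} [NormedAddCommGroup F] [NormedSpace ℝ F]

lemma pd_congr {u v : Coord d → F} (h : u =ᶠ[𝓝[S] x] v) (hx : x ∈ S) (i : Fin d) :
    pd S u i x = pd S v i x := by
  rw [pd, h.fderivWithin_eq_of_mem hx, pd]

lemma pd_add (hS : UniqueDiffWithinAt ℝ S x) {u v : Coord d → F}
    (hu : DifferentiableWithinAt ℝ u S x) (hv : DifferentiableWithinAt ℝ v S x) (i : Fin d) :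
    pd S (u + v) i x = pd S u i x + pd S v i x := by
  simp [pd, fderivWithin_add hS hu hv]

lemma pd_smul (hS : UniqueDiffWithinAt ℝ S x) {s : Coord d → ℝ} {u : Coord d → F}
    (hs : DifferentiableWithinAt ℝ s S x) (hu : DifferentiableWithinAt ℝ u S x) (i : Fin d) :
    pd S (s • u) i x = s x • pd S u i x + pd S s i x • u x := by
  simp [pd, fderivWithin_smul hS hs hu]

lemma pd_const_smul [NormedSpace ℂ F] (hS : UniqueDiffWithinAt ℝ S x)
    {u : Coord d → F} (a : ℂ) (hu : DifferentiableWithinAt ℝ u S x) (i : Fin d) :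
    pd S (a • u) i x = a • pd S u i x := by
  simp [pd, fderivWithin_const_smul hS hu]

lemma pd_log (hS : UniqueDiffWithinAt ℝ S x) {s : Coord d → ℝ}
    (hs : DifferentiableWithinAt ℝ s S x) (h0 : s x ≠ 0) (i : Fin d) :
    pd S (fun z => Real.log (s z)) i x = (s x)⁻¹ * pd S s i x := by
  simp [pd, fderivWithin.log hs h0 hS]

lemma pd_inv (hS : UniqueDiffWithinAt ℝ S x) {s : Coord d → ℝ}
    (hs : DifferentiableWithinAt ℝ s S x) (h0 : s x ≠ 0) (i : Fin d) :
    pd S s⁻¹ i x = -((s x)⁻¹ ^ 2 * pd S s i x) := by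
  have h : HasFDerivWithinAt s⁻¹ (-(s x ^ 2)⁻¹ • fderivWithin ℝ s S x) S x :=
    (hasDerivAt_inv h0).comp_hasFDerivWithinAt x hs.hasFDerivWithinAt
  simp [pd, h.fderivWithin hS]

lemma eventually_differentiableWithinAt {u : Coord d → F} (hx : x ∈ S)
    (hu : ContDiffWithinAt ℝ 1 u S x) : ∀ᶠ z in 𝓝[S] x, DifferentiableWithinAt ℝ u S z := by
  have h := hu.eventually (by simp)
  rw [Set.insert_eq_of_mem hx] at h
  exact h.mono fun z hz => hz.differentiableWithinAt one_ne_zero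

end pd

section nabla

variable {V W : Coord d → TractorTensor d k}

lemma nabla_congr (h : V =ᶠ[𝓝[S] x] W) (hx : x ∈ S) (i : Fin d) :
    nabla S G V i x = nabla S G W i x := by
  rw [nabla, nabla, pd_congr h hx, h.eq_of_nhdsWithin hx]

lemma nabla_add (hS : UniqueDiffWithinAt ℝ S x) (hV : DifferentiableWithinAt ℝ V S x)
    (hW : DifferentiableWithinAt ℝ W S x) (i : Fin d) :
    nabla S G (V + W) i x = nabla S G V i x + nabla S G W i x := by
  simp only [nabla, pd_add hS hV hW, Pi.add_apply, tensorAct_add]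
  abel

lemma nabla_const_smul (hS : UniqueDiffWithinAt ℝ S x) (a : ℂ)
    (hV : DifferentiableWithinAt ℝ V S x) (i : Fin d) :
    nabla S G (a • V) i x = a • nabla S G V i x := by
  simp only [nabla, pd_const_smul hS a hV, Pi.smul_apply, tensorAct_smul, smul_add]

lemma nabla_smul (hS : UniqueDiffWithinAt ℝ S x) {s : Coord d → ℝ}
    (hs : DifferentiableWithinAt ℝ s S x) (hV : DifferentiableWithinAt ℝ V S x) (i : Fin d) :
    nabla S G (s • V) i x = s x • nabla S G V i x + pd S s i x • V x := by
  simp only [nabla, pd_smul hS hs hV, Pi.smul_apply', tensorAct_smul, smul_add]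
  abel

lemma nabla_const_rank_zero (e : TractorTensor d 0) (i : Fin d) :
    nabla S G (fun _ => e) i = 0 := by
  ext1 z
  simp [nabla, pd, tensorAct_rank_zero]

lemma differentiableWithinAt_nabla (hS : UniqueDiffOn ℝ S)
    (hG : ∀ i j, ContDiffOn ℝ ∞ (fun x => G x i j) S) (hdet : ∀ x ∈ S, (G x).det ≠ 0)
    (hx : x ∈ S) (hV : ContDiffWithinAt ℝ 2 V S x) (i : Fin d) :
    DifferentiableWithinAt ℝ (nabla S G V i) S x :=
  ((contDiffWithinAt_pd hS hx hV one_add_one_eq_two.le i).differentiableWithinAt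
    one_ne_zero).add <| differentiableWithinAt_tensorAct
      ((contDiffOn_tractorForm hS hG hdet i x hx).differentiableWithinAt (by simp))
      (hV.differentiableWithinAt two_ne_zero)

end nabla

variable (S G) in
/-- The second covariant derivative `∇ᵢ ∇ⱼ V` of a tractor field. -/
def hessian (V : Coord d → TractorTensor d k) (i j : Fin d) (x : Coord d) : TractorTensor d k :=
  nabla S G (nabla S G V j) i x - ∑ m, christoffel S G m i j x • nabla S G V m x

variable (S G) in
/-- The second covariant derivative `∇ᵢ ∇ⱼ s` of a real function. -/
def scalarHessian (s : Coord d → ℝ) (i j : Fin d) (x : Coord d) : ℝ :=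
  pd S (pd S s j) i x - ∑ m, christoffel S G m i j x * pd S s m x

variable (S G) in
/-- The Laplacian `gⁱʲ ∇ᵢ ∇ⱼ s` of a real function. -/
def scalarLaplacian (s : Coord d → ℝ) (x : Coord d) : ℝ :=
  ∑ i, ∑ j, (G x)⁻¹ i j * scalarHessian S G s i j x

lemma laplacian_eq_sum_hessian (V : Coord d → TractorTensor d k) :
    laplacian S G V x = ∑ i, ∑ j, (G x)⁻¹ i j • hessian S G V i j x :=
  rfl

lemma hessian_smul (hS : UniqueDiffOn ℝ S)
    (hG : ∀ i j, ContDiffOn ℝ ∞ (fun x => G x i j) S) (hdet : ∀ x ∈ S, (G x).det ≠ 0)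
    (hx : x ∈ S) {s : Coord d → ℝ} {V : Coord d → TractorTensor d k}
    (hs : ContDiffWithinAt ℝ 2 s S x) (hV : ContDiffWithinAt ℝ 2 V S x) (i j : Fin d) :
    hessian S G (s • V) i j x = s x • hessian S G V i j x + pd S s i x • nabla S G V j x
      + pd S s j x • nabla S G V i x + scalarHessian S G s i j x • V x := by
  have hsx := hs.differentiableWithinAt two_ne_zero
  have hVx := hV.differentiableWithinAt two_ne_zero
  have hds := (contDiffWithinAt_pd hS hx hs one_add_one_eq_two.le j).differentiableWithinAt
    one_ne_zero
  have hdV := differentiableWithinAt_nabla hS hG hdet hx hV j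
  have hfirst : nabla S G (s • V) j =ᶠ[𝓝[S] x] s • nabla S G V j + pd S s j • V := by
    filter_upwards [eventually_differentiableWithinAt hx (hs.of_le one_le_two),
      eventually_differentiableWithinAt hx (hV.of_le one_le_two), self_mem_nhdsWithin]
      with z hsz hVz hz using nabla_smul (hS z hz) hsz hVz j
  have hsecond : nabla S G (nabla S G (s • V) j) i x
      = s x • nabla S G (nabla S G V j) i x + pd S s i x • nabla S G V j x
        + (pd S s j x • nabla S G V i x + pd S (pd S s j) i x • V x) := by
    rw [nabla_congr hfirst hx, nabla_add (hS x hx) (hsx.smul hdV) (hds.smul hVx),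
      nabla_smul (hS x hx) hsx hdV, nabla_smul (hS x hx) hds hVx]
  have hchristoffel : ∑ m, christoffel S G m i j x • nabla S G (s • V) m x
      = s x • ∑ m, christoffel S G m i j x • nabla S G V m x
        + (∑ m, christoffel S G m i j x * pd S s m x) • V x := by
    simp only [nabla_smul (hS x hx) hsx hVx, smul_add, Finset.sum_add_distrib, Finset.smul_sum,
      smul_smul, mul_comm (s x)]
    exact congrArg _ (Finset.sum_smul ..).symm
  rw [hessian, hsecond, hchristoffel, hessian, scalarHessian]
  module

lemma laplacian_smul (hS : UniqueDiffOn ℝ S)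
    (hG : ∀ i j, ContDiffOn ℝ ∞ (fun x => G x i j) S) (hdet : ∀ x ∈ S, (G x).det ≠ 0)
    (hsymm : (G x).IsSymm) (hx : x ∈ S) {s : Coord d → ℝ} {V : Coord d → TractorTensor d k}
    (hs : ContDiffWithinAt ℝ 2 s S x) (hV : ContDiffWithinAt ℝ 2 V S x) :
    laplacian S G (s • V) x = s x • laplacian S G V x + scalarLaplacian S G s x • V x
      + (2 : ℝ) • ∑ i, ∑ j, (G x)⁻¹ i j • pd S s i x • nabla S G V j x := by
  have hcross : ∑ i, ∑ j, (G x)⁻¹ i j • pd S s j x • nabla S G V i x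
      = ∑ i, ∑ j, (G x)⁻¹ i j • pd S s i x • nabla S G V j x := by
    rw [Finset.sum_comm]
    simp only [hsymm.inv.apply]
  have hzeroth : ∑ i, ∑ j, (G x)⁻¹ i j • scalarHessian S G s i j x • V x
      = scalarLaplacian S G s x • V x := by
    ext
    simp [scalarLaplacian, Finset.sum_mul, mul_assoc]
  simp only [laplacian_eq_sum_hessian, hessian_smul hS hG hdet hx hs hV, smul_add,
    Finset.sum_add_distrib, hcross, hzeroth, smul_comm _ (s x), ← Finset.smul_sum]
  module

lemma laplacian_const_rank_zero (e : TractorTensor d 0) : laplacian S G (fun _ => e) x = 0 := by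
  have h : nabla S G (0 : Coord d → TractorTensor d 0) = 0 :=
    funext fun i => nabla_const_rank_zero 0 i
  ext
  simp [laplacian, nabla_const_rank_zero, h]

lemma scalarHessian_log (hS : UniqueDiffOn ℝ S) (hx : x ∈ S) {s : Coord d → ℝ}
    (hs : ContDiffWithinAt ℝ 2 s S x) (h0 : s x ≠ 0) (i j : Fin d) :
    scalarHessian S G (fun z => Real.log (s z)) i j x
      = (s x)⁻¹ * scalarHessian S G s i j x - (s x)⁻¹ ^ 2 * (pd S s i x * pd S s j x) := by
  have hsx := hs.differentiableWithinAt two_ne_zero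
  have hds := (contDiffWithinAt_pd hS hx hs one_add_one_eq_two.le j).differentiableWithinAt
    one_ne_zero
  have hfirst : pd S (fun z => Real.log (s z)) j =ᶠ[𝓝[S] x] s⁻¹ • pd S s j := by
    filter_upwards [eventually_differentiableWithinAt hx (hs.of_le one_le_two),
      hs.continuousWithinAt.eventually_ne h0, self_mem_nhdsWithin]
      with z hsz hz0 hz using pd_log (hS z hz) hsz hz0 j
  have hsecond : pd S (pd S (fun z => Real.log (s z)) j) i x
      = (s x)⁻¹ * pd S (pd S s j) i x - (s x)⁻¹ ^ 2 * (pd S s i x * pd S s j x) := by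
    rw [pd_congr hfirst hx, pd_smul (hS x hx) (hsx.inv h0) hds, pd_inv (hS x hx) hsx h0]
    simp only [Pi.inv_apply, smul_eq_mul]
    ring
  simp only [scalarHessian, hsecond, pd_log (hS x hx) hsx h0, mul_left_comm _ (s x)⁻¹,
    ← Finset.mul_sum]
  ring

lemma scalarLaplacian_log (hS : UniqueDiffOn ℝ S) (hx : x ∈ S) {s : Coord d → ℝ}
    (hs : ContDiffWithinAt ℝ 2 s S x) (h0 : s x ≠ 0) :
    scalarLaplacian S G (fun z => Real.log (s z)) x
      = (s x)⁻¹ * scalarLaplacian S G s x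
        - (s x)⁻¹ ^ 2 * ∑ i, ∑ j, (G x)⁻¹ i j * (pd S s i x * pd S s j x) := by
  simp only [scalarLaplacian, scalarHessian_log hS hx hs h0, mul_sub, Finset.sum_sub_distrib,
    Finset.mul_sum, mul_left_comm]

end Coordinates

variable {d k : ℕ} {H : Type*} [TopologicalSpace H] {I : ModelWithCorners ℝ (Coord d) H}
  {M : Type*} [TopologicalSpace M] [ChartedSpace H M]

/-! ### Metrics and tractor fields in a chart -/

section Chart

variable [IsManifold I ∞ M]

lemma fromChart_self (p : M) (v : Coord d) : fromChart I p p v = v := by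
  have : IsManifold I 1 M := .of_le (n := ∞) (by simp)
  exact tangentCoordChange_self (E := Coord d) (mem_extChartAt_source p)

lemma tangentCoordChange_fromChart {p q : M} (hq : q ∈ (extChartAt I p).source) (v : Coord d) :
    tangentCoordChange I q p q (fromChart I p q v) = v := by
  have : IsManifold I 1 M := .of_le (n := ∞) (by simp)
  exact (tangentCoordChange_comp (E := Coord d) ⟨⟨hq, mem_extChartAt_source q⟩, hq⟩).trans
    (tangentCoordChange_self hq)

lemma fromChart_tangentCoordChange {p q : M} (hq : q ∈ (extChartAt I p).source) (v : Coord d) :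
    fromChart I p q (tangentCoordChange I q p q v) = v := by
  have : IsManifold I 1 M := .of_le (n := ∞) (by simp)
  have hq' := mem_extChartAt_source (I := I) q
  exact (tangentCoordChange_comp (E := Coord d) ⟨⟨hq', hq⟩, hq'⟩).trans
    (tangentCoordChange_self hq')

namespace PseudoMetric

variable (g : PseudoMetric I M)

lemma gram_eq_chartMatrix (p : M) : g.gram p = chartMatrix I g.val p (extChartAt I p p) := by
  have h : ∀ q, q = p → ∀ i j, g.val p (coordVec i : Coord d) (coordVec j : Coord d)
      = g.val q (fromChart I p q (coordVec i)) (fromChart I p q (coordVec j)) := by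
    rintro q rfl i j
    rw [fromChart_self, fromChart_self]
  ext i j
  exact h _ (extChartAt_to_inv p) i j

lemma isSymm_chartMatrix (p : M) (x : Coord d) : (chartMatrix I g.val p x).IsSymm := by
  ext i j
  exact g.symm _ _ _

lemma det_chartMatrix_ne_zero (p : M) {x : Coord d} (hx : x ∈ (extChartAt I p).target) :
    (chartMatrix I g.val p x).det ≠ 0 := by
  set q := (extChartAt I p).symm x
  have hqs : q ∈ (extChartAt I p).source := (extChartAt I p).map_target hx
  let b : Coord d →L[ℝ] Coord d →L[ℝ] ℝ := g.val q
  let A : Coord d →L[ℝ] Coord d := fromChart I p q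
  let B : Coord d →ₗ[ℝ] Coord d →ₗ[ℝ] ℝ := b.toLinearMap₁₂.compl₁₂ A.toLinearMap A.toLinearMap
  let e := (EuclideanSpace.basisFun (Fin d) ℝ).toBasis
  have hB : B.SeparatingLeft := fun u hu => by
    have hAu : A u = 0 := g.nondegenerate q _ fun v => by
      have h := hu (tangentCoordChange I q p q v)
      change b (A u) (A _) = 0 at h
      rwa [show A (tangentCoordChange I q p q v) = v from fromChart_tangentCoordChange hqs v] at h
    rw [← tangentCoordChange_fromChart hqs u]
    exact (congrArg _ hAu).trans (map_zero _)
  have hBe : LinearMap.toMatrix₂ e e B = chartMatrix I g.val p x := by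
    ext i j
    simp only [LinearMap.toMatrix₂_apply, e, OrthonormalBasis.coe_toBasis,
      EuclideanSpace.basisFun_apply]
    rfl
  exact hBe ▸ (LinearMap.separatingLeft_iff_det_ne_zero e).1 hB

end PseudoMetric

lemma chartField_self (v : M → TractorTensor d k) (p : M) :
    chartField I v p (extChartAt I p p) = v p := by
  have h : ∀ q, q = p → (v q).compContinuousLinearMap (fun _ =>
      (ContinuousLinearMap.id ℝ ℝ).prodMap
        (ContinuousLinearMap.prodMap (fromChart I p q) (ContinuousLinearMap.id ℝ ℝ))) = v p := by
    rintro q rfl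
    ext α
    simp only [ContinuousMultilinearMap.compContinuousLinearMap_apply]
    congr 1
    ext1 i
    exact Prod.ext rfl (Prod.ext (fromChart_self q _) rfl)
  exact h _ (extChartAt_to_inv p)

end Chart

lemma eventually_extChartAt_symm {p : M} {P : M → Prop} (h : ∀ᶠ q in 𝓝 p, P q) :
    ∀ᶠ x in 𝓝[(extChartAt I p).target] (extChartAt I p p), P ((extChartAt I p).symm x) := by
  have hcont := continuousOn_extChartAt_symm (I := I) p _ (mem_extChartAt_target p)
  rw [ContinuousWithinAt, extChartAt_to_inv] at hcont
  exact hcont.eventually h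

variable [IsManifold I ∞ M]

lemma chartField_congr {v v' : M → TractorTensor d k} {p : M} (h : v =ᶠ[𝓝 p] v') :
    chartField I v p =ᶠ[𝓝[(extChartAt I p).target] (extChartAt I p p)] chartField I v' p := by
  filter_upwards [eventually_extChartAt_symm h] with x hx
  rw [chartField, chartField, hx]

lemma contDiffWithinAt_comp_extChartAt_symm {n : WithTop ℕ∞} {u : M → ℝ} {p : M} (hn : n ≤ ∞)
    (hu : ContMDiffAt I 𝓘(ℝ) n u p) :
    ContDiffWithinAt ℝ n (fun x => u ((extChartAt I p).symm x)) (extChartAt I p).target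
      (extChartAt I p p) := by
  rw [← contMDiffWithinAt_iff_contDiffWithinAt]
  have hsymm := (contMDiffOn_extChartAt_symm (n := ∞) (I := I) p _
    (mem_extChartAt_target p)).of_le hn
  exact ContMDiffAt.comp_contMDiffWithinAt _ (by rwa [extChartAt_to_inv]) hsymm

/-! ### Leibniz rules on the manifold -/

variable (I) in
/-- The partial derivative `∂ᵢ u` at `p` of a real function, in the preferred chart at `p`. -/
def partialDeriv (u : M → ℝ) (p : M) (i : Fin d) : ℝ :=
  pd (extChartAt I p).target (fun x => u ((extChartAt I p).symm x)) i (extChartAt I p p)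

/-- The Laplacian `Δ u` of a real function in the scale `g`, at `p`. -/
def scalarBox (g : PseudoMetric I M) (u : M → ℝ) (p : M) : ℝ :=
  scalarLaplacian (extChartAt I p).target (chartMatrix I g.val p)
    (fun x => u ((extChartAt I p).symm x)) (extChartAt I p p)

/-- The pairing `ν ↦ g⁻¹(du, ν)` at `p` of the differential of a real function with `W`-valued
covectors, given by their components. -/
def gradPairing {W : Type*} [AddCommGroup W] [Module ℂ W] (g : PseudoMetric I M) (u : M → ℝ)
    (p : M) : (Fin d → W) →ₗ[ℂ] W :=
  ∑ i, ∑ j, (((g.gram p)⁻¹ i j : ℝ) : ℂ) • (partialDeriv I u p i : ℂ) • LinearMap.proj j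

/-- The square `g⁻¹(du, du)` at `p` of the differential of a real function. -/
def gradSq (g : PseudoMetric I M) (u : M → ℝ) (p : M) : ℝ :=
  ∑ i, ∑ j, (g.gram p)⁻¹ i j * (partialDeriv I u p i * partialDeriv I u p j)

lemma real_smul_eq_coe_smul (r : ℝ) (T : TractorTensor d k) : r • T = (r : ℂ) • T := by
  ext
  simp

lemma gradPairing_apply {W : Type*} [AddCommGroup W] [Module ℂ W] (g : PseudoMetric I M)
    (u : M → ℝ) (p : M) (ν : Fin d → W) : gradPairing g u p ν
      = ∑ i, ∑ j, (((g.gram p)⁻¹ i j : ℝ) : ℂ) • (partialDeriv I u p i : ℂ) • ν j := by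
  simp [gradPairing]

lemma gradPairing_partialDeriv_smul {W : Type*} [AddCommGroup W] [Module ℂ W]
    (g : PseudoMetric I M) (u : M → ℝ) (p : M) (F : W) :
    gradPairing g u p (fun j => (partialDeriv I u p j : ℂ) • F) = (gradSq g u p : ℂ) • F := by
  simp only [gradPairing_apply, gradSq, Finset.sum_smul, smul_smul, Complex.ofReal_sum,
    Complex.ofReal_mul]

section log

variable {u : M → ℝ} {p : M}

lemma partialDeriv_log (hu : ContMDiffAt I 𝓘(ℝ) 1 u p) (h0 : u p ≠ 0) (i : Fin d) :
    partialDeriv I (fun q => Real.log (u q)) p i = (u p)⁻¹ * partialDeriv I u p i := by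
  have h := pd_log (uniqueDiffOn_extChartAt_target (I := I) p _ (mem_extChartAt_target p))
    ((contDiffWithinAt_comp_extChartAt_symm (by simp) hu).differentiableWithinAt one_ne_zero)
    (by rwa [extChartAt_to_inv]) i
  rwa [extChartAt_to_inv] at h

lemma gradPairing_log {W : Type*} [AddCommGroup W] [Module ℂ W] (g : PseudoMetric I M)
    (hu : ContMDiffAt I 𝓘(ℝ) 1 u p) (h0 : u p ≠ 0) (ν : Fin d → W) :
    gradPairing g (fun q => Real.log (u q)) p ν = (u p : ℂ)⁻¹ • gradPairing g u p ν := by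
  simp only [gradPairing_apply, partialDeriv_log hu h0, Finset.smul_sum, smul_smul,
    Complex.ofReal_mul, Complex.ofReal_inv, mul_left_comm]

lemma scalarBox_log (g : PseudoMetric I M) (hu : ContMDiffAt I 𝓘(ℝ) 2 u p) (h0 : u p ≠ 0) :
    scalarBox g (fun q => Real.log (u q)) p
      = (u p)⁻¹ * scalarBox g u p - (u p)⁻¹ ^ 2 * gradSq g u p := by
  have h := scalarLaplacian_log (G := chartMatrix I g.val p)
    (uniqueDiffOn_extChartAt_target (I := I) p) (mem_extChartAt_target p)
    (contDiffWithinAt_comp_extChartAt_symm (WithTop.coe_le_coe.2 le_top) hu)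
    (by rwa [extChartAt_to_inv])
  rwa [extChartAt_to_inv, ← g.gram_eq_chartMatrix] at h

end log

section covDeriv

variable {V W : Family I M k} {g : PseudoMetric I M} {p : M}

lemma covDeriv_congr (h : V g =ᶠ[𝓝 p] W g) : covDeriv V g p = covDeriv W g p :=
  funext fun i => nabla_congr (chartField_congr h) (mem_extChartAt_target p) i

variable (hV : DifferentiableWithinAt ℝ (chartField I (V g) p) (extChartAt I p).target
  (extChartAt I p p))
include hV

lemma covDeriv_add (hW : DifferentiableWithinAt ℝ (chartField I (W g) p)
      (extChartAt I p).target (extChartAt I p p)) :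
    covDeriv (V + W) g p = covDeriv V g p + covDeriv W g p :=
  funext fun i => nabla_add
    (uniqueDiffOn_extChartAt_target p _ (mem_extChartAt_target p)) hV hW i

lemma covDeriv_const_smul (a : ℂ) : covDeriv (a • V) g p = a • covDeriv V g p :=
  funext fun i => nabla_const_smul
    (uniqueDiffOn_extChartAt_target p _ (mem_extChartAt_target p)) a hV i

lemma covDeriv_smul {u : RealFamily I M} (hu : ContMDiffAt I 𝓘(ℝ) 1 (u g) p) (i : Fin d) :
    covDeriv (u • V) g p i = u g p • covDeriv V g p i + partialDeriv I (u g) p i • V g p := by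
  have h := nabla_smul (G := chartMatrix I g.val p)
    (uniqueDiffOn_extChartAt_target (I := I) p _ (mem_extChartAt_target p))
    ((contDiffWithinAt_comp_extChartAt_symm (by simp) hu).differentiableWithinAt one_ne_zero) hV i
  rwa [extChartAt_to_inv, chartField_self] at h

omit hV in
lemma boxOp_smul (hV : ContDiffWithinAt ℝ 2 (chartField I (V g) p) (extChartAt I p).target
      (extChartAt I p p)) {u : RealFamily I M} (hu : ContMDiffAt I 𝓘(ℝ) 2 (u g) p) :
    boxOp (u • V) g p = u g p • boxOp V g p + scalarBox g (u g) p • V g p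
      + (2 : ℝ) • gradPairing g (u g) p (covDeriv V g p) := by
  have h := laplacian_smul (uniqueDiffOn_extChartAt_target (I := I) p) (g.smooth p)
    (fun x => g.det_chartMatrix_ne_zero p) (g.isSymm_chartMatrix p _) (mem_extChartAt_target p)
    (contDiffWithinAt_comp_extChartAt_symm (WithTop.coe_le_coe.2 le_top) hu) hV
  rw [extChartAt_to_inv, chartField_self, ← g.gram_eq_chartMatrix] at h
  simp only [gradPairing_apply, ← real_smul_eq_coe_smul]
  exact h

end covDeriv

/-! ### Covariant derivatives of `log σ f` -/

section Weighted

variable {c : Set (PseudoMetric I M)} {w : ℂ} {U : Set M} {f V : Family I M k}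
  {σ : RealFamily I M} {g : PseudoMetric I M} {p : M}

lemma IsWeightedTractor.contDiffWithinAt_chartField (hf : IsWeightedTractor c w U f) (hg : g ∈ c)
    (hp : U ∈ 𝓝 p) :
    ContDiffWithinAt ℝ ∞ (chartField I (f g) p) (extChartAt I p).target (extChartAt I p p) := by
  have hU := eventually_extChartAt_symm (I := I) hp
  refine (hf.smooth g hg p _ ⟨mem_extChartAt_target p, ?_⟩).mono_of_mem_nhdsWithin
    (Filter.inter_mem self_mem_nhdsWithin hU)
  rw [Set.mem_preimage, extChartAt_to_inv]
  exact mem_of_mem_nhds hp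

lemma IsScale.contMDiffAt_log (hσ : IsScale c σ) (hg : g ∈ c) (h0 : σ g p ≠ 0) :
    ContMDiffAt I 𝓘(ℝ) ∞ (fun q => Real.log (σ g q)) p :=
  ContDiffAt.comp_contMDiffAt (Real.contDiffAt_log.2 h0) (hσ.smooth g hg p)

lemma logXOp_eq_smul (σ : RealFamily I M) (V : Family I M k) :
    logXOp σ V = (fun g q => Real.log (σ g q) : RealFamily I M) • V := rfl

lemma IsWeightedTractor.covDeriv_logXOp (hf : IsWeightedTractor c w U f) (hσ : IsScale c σ)
    (hg : g ∈ c) (hp : U ∈ 𝓝 p) (h0 : σ g p ≠ 0) (i : Fin d) :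
    covDeriv (logXOp σ f) g p i = (Real.log (σ g p) : ℂ) • covDeriv f g p i
      + (σ g p : ℂ)⁻¹ • (partialDeriv I (σ g) p i : ℂ) • f g p := by
  have h := covDeriv_smul (u := fun g q => Real.log (σ g q))
    ((hf.contDiffWithinAt_chartField hg hp).differentiableWithinAt (by simp))
    ((hσ.contMDiffAt_log hg h0).of_le (by simp)) i
  rw [partialDeriv_log ((hσ.smooth g hg p).of_le (by simp)) h0] at h
  simpa only [logXOp_eq_smul, real_smul_eq_coe_smul, Complex.ofReal_mul, Complex.ofReal_inv,
    mul_smul] using h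

lemma IsWeightedTractor.boxOp_logXOp (hf : IsWeightedTractor c w U f) (hσ : IsScale c σ)
    (hg : g ∈ c) (hp : U ∈ 𝓝 p) (h0 : σ g p ≠ 0) :
    boxOp (logXOp σ f) g p = (Real.log (σ g p) : ℂ) • boxOp f g p
      + ((σ g p : ℂ)⁻¹ * scalarBox g (σ g) p - (σ g p : ℂ)⁻¹ ^ 2 * gradSq g (σ g) p) • f g p
      + (2 : ℂ) • (σ g p : ℂ)⁻¹ • gradPairing g (σ g) p (covDeriv f g p) := by
  have htwo : (2 : WithTop ℕ∞) ≤ ∞ := WithTop.coe_le_coe.2 le_top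
  have h := boxOp_smul (u := fun g q => Real.log (σ g q))
    ((hf.contDiffWithinAt_chartField hg hp).of_le htwo)
    ((hσ.contMDiffAt_log hg h0).of_le htwo)
  rw [scalarBox_log g ((hσ.smooth g hg p).of_le htwo) h0,
    gradPairing_log g ((hσ.smooth g hg p).of_le (by simp)) h0] at h
  simpa only [logXOp_eq_smul, real_smul_eq_coe_smul, Complex.ofReal_mul, Complex.ofReal_inv,
    Complex.ofReal_sub, Complex.ofReal_pow, Complex.ofReal_ofNat] using h

/-! ### The weight operator -/

lemma PseudoMetric.rescale_mem_conformalClass {g₀ g : PseudoMetric I M}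
    (hg : g ∈ g₀.conformalClass) (Υ : C^∞⟮I, M; 𝓘(ℝ), ℝ⟯) : g.rescale Υ ∈ g₀.conformalClass := by
  obtain ⟨Ω, rfl⟩ := hg
  refine ⟨Υ + Ω, PseudoMetric.ext (funext fun p => ?_)⟩
  simp only [rescale, smul_smul, ← Real.exp_add, ContMDiffMap.coe_add, Pi.add_apply, mul_add]

lemma PseudoMetric.dualChange_const (g : PseudoMetric I M) (s : ℝ) (p : M) (α : DualTractor d) :
    g.dualChange (ContMDiffMap.const s) p α
      = (Real.exp s * α.1, Real.exp s • α.2.1, Real.exp (-s) * α.2.2) := by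
  have hdiff : differential (I := I) (ContMDiffMap.const s) p = 0 := mfderiv_const
  have hgrad : g.gradient (ContMDiffMap.const s) p = 0 := by simp [gradient, hdiff]
  have hs : (ContMDiffMap.const s : C^∞⟮I, M; 𝓘(ℝ), ℝ⟯) p = s := rfl
  simp [dualChange, hdiff, hgrad, hs]

lemma PseudoMetric.changeSplitting_const_neg (g g' : PseudoMetric I M) (s : ℝ) (p : M)
    (t : TractorTensor d k) :
    g'.changeSplitting (ContMDiffMap.const (-s)) p
      (g.changeSplitting (ContMDiffMap.const s) p t) = t := by
  ext α
  simp only [changeSplitting, ContinuousMultilinearMap.compContinuousLinearMap_apply]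
  congr 1
  ext1 i
  rw [dualChange_const, dualChange_const]
  simp [← mul_assoc, smul_smul, ← Real.exp_add]

lemma weightOp_eq_of_rescale {V : Family I M k} {g : PseudoMetric I M} {p : M}
    {t : TractorTensor d k} {φ : ℝ → ℂ} {φ' : ℂ} (hφ : HasDerivAt φ φ' 0)
    (hV : ∀ s : ℝ, V (g.rescale (ContMDiffMap.const s)) p
      = φ s • g.changeSplitting (ContMDiffMap.const s) p t) :
    weightOp V g p = φ' • t := by
  have h (s : ℝ) : (g.rescale (ContMDiffMap.const s)).changeSplitting (ContMDiffMap.const (-s)) p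
      (V (g.rescale (ContMDiffMap.const s)) p) = φ s • t :=
    calc _ = φ s • (g.rescale (ContMDiffMap.const s)).changeSplitting (ContMDiffMap.const (-s)) p
          (g.changeSplitting (ContMDiffMap.const s) p t) := by rw [hV]; rfl
      _ = φ s • t := by rw [PseudoMetric.changeSplitting_const_neg]
  simp only [weightOp, h]
  exact (hφ.smul_const t).deriv

lemma IsWeightedTractor.weightOp_eq_of_rescale (hf : IsWeightedTractor c w U f) (hg : g ∈ c)
    (hp : p ∈ U) {φ : ℝ → ℂ} {φ' : ℂ} (hφ : HasDerivAt φ φ' 0)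
    (hV : ∀ s : ℝ, V (g.rescale (ContMDiffMap.const s)) p
      = φ s • f (g.rescale (ContMDiffMap.const s)) p) :
    weightOp V g p = (w * φ 0 + φ') • f g p := by
  have hexp : HasDerivAt (fun s : ℝ => Complex.exp (w * s)) w 0 := by
    simpa using ((Complex.ofRealCLM.hasDerivAt (x := 0)).const_mul w).cexp
  refine (ConformalTractor.weightOp_eq_of_rescale (t := f g p) (hφ.mul hexp) fun s => ?_).trans ?_
  · rw [hV, hf.equivariant g hg _ p hp, smul_smul]
    rfl
  · congr 1
    simp
    ring

section RescaleConst

variable (hc : ∀ g ∈ c, ∀ s : ℝ, g.rescale (ContMDiffMap.const s) ∈ c)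
include hc

lemma IsWeightedTractor.weightOp_of_eq_smul (hf : IsWeightedTractor c w U f) (hg : g ∈ c)
    (hp : p ∈ U) (a : ℂ) (hV : ∀ g ∈ c, V g p = a • f g p) : weightOp V g p = (w * a) • f g p := by
  simpa using hf.weightOp_eq_of_rescale hg hp (hasDerivAt_const 0 a) fun s => hV _ (hc g hg s)

lemma IsWeightedTractor.weightOp_apply (hf : IsWeightedTractor c w U f) (hg : g ∈ c)
    (hp : p ∈ U) : weightOp f g p = w • f g p := by
  simpa using hf.weightOp_of_eq_smul hc hg hp 1 fun _ _ => (one_smul ℂ _).symm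

lemma IsWeightedTractor.weightOp_of_eq_log_smul (hf : IsWeightedTractor c w U f) (hσ : IsScale c σ)
    (hg : g ∈ c) (hp : p ∈ U) (h0 : σ g p ≠ 0) (a b : ℂ)
    (hV : ∀ g ∈ c, σ g p ≠ 0 → V g p = (a + b * Real.log (σ g p)) • f g p) :
    weightOp V g p = (w * (a + b * Real.log (σ g p)) + b) • f g p := by
  have hφ : HasDerivAt (fun s : ℝ => a + b * (s + Real.log (σ g p))) b 0 := by
    simpa using
      (((Complex.ofRealCLM.hasDerivAt (x := 0)).add_const (Real.log (σ g p) : ℂ)).const_mul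
        b).const_add a
  refine (hf.weightOp_eq_of_rescale hg hp hφ fun s => ?_).trans (by simp)
  have hs : σ (g.rescale (ContMDiffMap.const s)) p = Real.exp s * σ g p := hσ.equivariant g hg _ p
  rw [hV _ (hc g hg s) (by simp [hs, h0]), hs, Real.log_mul (Real.exp_ne_zero s) h0, Real.log_exp,
    Complex.ofReal_add]

/-! ### The Thomas-D operator on weighted tractors and on their products with `log σ` -/

lemma IsWeightedTractor.thomasD_eq (hf : IsWeightedTractor c w U f) (hg : g ∈ c) (hp : U ∈ 𝓝 p) :
    thomasD f g p =
      { top := ((d + 2 * w - 2) * w) • f g p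
        mid := (d + 2 * w - 2) • covDeriv f g p
        bot := -(boxOp f g p + (traceJ g p * w) • f g p) } := by
  have hpU := mem_of_mem_nhds hp
  have hww : weightOp (weightOp f) g p = (w * w) • f g p :=
    hf.weightOp_of_eq_smul hc hg hpU w fun g hg => hf.weightOp_apply hc hg hpU
  have hmid : (hOp f - (2 : ℂ) • f) g =ᶠ[𝓝 p] ((d + 2 * w - 2) • f) g := by
    filter_upwards [hp] with q hq
    simp only [hOp, Pi.sub_apply, Pi.add_apply, Pi.smul_apply, hf.weightOp_apply hc hg hq]
    module
  simp only [thomasD, Slots.mk.injEq]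
  refine ⟨?_, ?_, ?_⟩
  · simp only [hOp, Pi.sub_apply, Pi.add_apply, Pi.smul_apply,
      hf.weightOp_apply hc hg hpU, hww]
    module
  · rw [covDeriv_congr hmid, covDeriv_const_smul
      ((hf.contDiffWithinAt_chartField hg hp).differentiableWithinAt (by simp))]
  · rw [hf.weightOp_apply hc hg hpU, real_smul_eq_coe_smul, smul_smul]

lemma IsWeightedTractor.thomasD_logXOp (hf : IsWeightedTractor c w U f) (hσ : IsScale c σ)
    (hg : g ∈ c) (hp : U ∈ 𝓝 p) (h0 : σ g p ≠ 0) :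
    thomasD (logXOp σ f) g p =
      { top := ((d + 2 * w - 2) * w * Real.log (σ g p) + (d + 4 * w - 2)) • f g p
        mid := (d + 2 * w - 2) • covDeriv (logXOp σ f) g p + (2 : ℂ) • covDeriv f g p
        bot := -(boxOp (logXOp σ f) g p
          + (traceJ g p * (1 + w * Real.log (σ g p))) • f g p) } := by
  have hpU := mem_of_mem_nhds hp
  have hlog (g : PseudoMetric I M) (q : M) : logXOp σ f g q = (Real.log (σ g q) : ℂ) • f g q :=
    real_smul_eq_coe_smul _ _
  have hw {q : M} (hq : q ∈ U) {g : PseudoMetric I M} (hg : g ∈ c) (h0 : σ g q ≠ 0) :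
      weightOp (logXOp σ f) g q = (1 + w * Real.log (σ g q)) • f g q := by
    simpa [add_comm] using hf.weightOp_of_eq_log_smul hc hσ hg hq h0 0 1 (V := logXOp σ f)
      fun g _ _ => by simp [hlog]
  have hww : weightOp (weightOp (logXOp σ f)) g p
      = (w * (1 + w * Real.log (σ g p)) + w) • f g p :=
    hf.weightOp_of_eq_log_smul hc hσ hg hpU h0 1 w fun g hg h0 => hw hpU hg h0
  have hmid : (hOp (logXOp σ f) - (2 : ℂ) • logXOp σ f) g =ᶠ[𝓝 p]
      ((d + 2 * w - 2) • logXOp σ f + (2 : ℂ) • f) g := by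
    filter_upwards [hp, (hσ.smooth g hg).continuous.continuousAt.eventually_ne h0] with q hq hq0
    simp only [hOp, Pi.sub_apply, Pi.add_apply, Pi.smul_apply, hw hq hg hq0, hlog]
    module
  have hfd := (hf.contDiffWithinAt_chartField hg hp).differentiableWithinAt (by simp)
  have hfl : DifferentiableWithinAt ℝ (chartField I (logXOp σ f g) p) (extChartAt I p).target
      (extChartAt I p p) :=
    ((contDiffWithinAt_comp_extChartAt_symm le_rfl
      (hσ.contMDiffAt_log hg h0)).differentiableWithinAt (by simp)).smul hfd
  simp only [thomasD, Slots.mk.injEq]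
  refine ⟨?_, ?_, ?_⟩
  · simp only [hOp, Pi.sub_apply, Pi.add_apply, Pi.smul_apply, hw hpU hg h0, hww]
    module
  · rw [covDeriv_congr hmid, covDeriv_add (hfl.const_smul (d + 2 * w - 2)) (hfd.const_smul (2 : ℂ)),
      covDeriv_const_smul hfl, covDeriv_const_smul hfd]
  · rw [hw hpU hg h0, real_smul_eq_coe_smul, smul_smul]

end RescaleConst

end Weighted

/-! ### The scale tractor -/

section ScaleTractor

variable {c : Set (PseudoMetric I M)} {σ : RealFamily I M} {g : PseudoMetric I M}

lemma toFamily_eq_smul_one (σ : RealFamily I M) :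
    toFamily σ = σ • toFamily (1 : RealFamily I M) := by
  ext g p α
  simp [toFamily]

lemma chartField_toFamily_one (g : PseudoMetric I M) (p : M) :
    chartField I (toFamily 1 g) p
      = fun _ => ContinuousMultilinearMap.constOfIsEmpty ℝ (fun _ => DualTractor d) (1 : ℂ) := by
  ext x α
  simp [chartField, toFamily]

lemma covDeriv_toFamily_one (g : PseudoMetric I M) (p : M) : covDeriv (toFamily 1) g p = 0 := by
  funext i
  rw [covDeriv, chartField_toFamily_one, nabla_const_rank_zero]
  rfl

lemma boxOp_toFamily_one (g : PseudoMetric I M) (p : M) : boxOp (toFamily 1) g p = 0 := by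
  rw [boxOp, chartField_toFamily_one, laplacian_const_rank_zero]

lemma toFamily_apply (σ : RealFamily I M) (g : PseudoMetric I M) (p : M)
    (α : Fin 0 → DualTractor d) : toFamily σ g p α = σ g p := rfl

variable (hσ : IsScale c σ)
include hσ

lemma IsScale.isWeightedTractor_toFamily : IsWeightedTractor c 1 Set.univ (toFamily σ) where
  smooth g hg p := by
    have hs : ContDiffOn ℝ ∞ (fun x => σ g ((extChartAt I p).symm x)) (extChartAt I p).target :=
      contMDiffOn_iff_contDiffOn.1
        ((hσ.smooth g hg).comp_contMDiffOn (contMDiffOn_extChartAt_symm p))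
    rw [Set.preimage_univ, Set.inter_univ, toFamily_eq_smul_one]
    refine hs.smul (g := chartField I (toFamily 1 g) p) ?_
    rw [chartField_toFamily_one]
    exact contDiffOn_const
  equivariant g hg Υ p _ := by
    ext α
    simp [toFamily, hσ.equivariant g hg, PseudoMetric.changeSplitting]

variable (hg : g ∈ c) (p : M)
include hg

lemma IsScale.covDeriv_toFamily (i : Fin d) :
    covDeriv (toFamily σ) g p i = (partialDeriv I (σ g) p i : ℂ) • toFamily 1 g p := by
  rw [toFamily_eq_smul_one, covDeriv_smul
    (by rw [chartField_toFamily_one]; exact differentiableWithinAt_const _)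
    ((hσ.smooth g hg p).of_le (by simp)), covDeriv_toFamily_one]
  ext α
  simp

lemma IsScale.boxOp_toFamily :
    boxOp (toFamily σ) g p = (scalarBox g (σ g) p : ℂ) • toFamily 1 g p := by
  rw [toFamily_eq_smul_one, boxOp_smul
    (by rw [chartField_toFamily_one]; exact contDiffWithinAt_const)
    ((hσ.smooth g hg p).of_le (WithTop.coe_le_coe.2 le_top)), covDeriv_toFamily_one,
    boxOp_toFamily_one]
  ext α
  simp

variable (hd : d ≠ 0) (hc : ∀ g ∈ c, ∀ s : ℝ, g.rescale (ContMDiffMap.const s) ∈ c)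
include hd hc

lemma IsScale.scaleTractor_eq :
    scaleTractor σ g p =
      { top := σ g p
        mid := fun i => partialDeriv I (σ g) p i
        bot := -(scalarBox g (σ g) p + traceJ g p * σ g p) / d } := by
  have hd' : (d : ℂ) ≠ 0 := Nat.cast_ne_zero.2 hd
  simp only [scaleTractor, hσ.isWeightedTractor_toFamily.thomasD_eq hc hg Filter.univ_mem,
    Slots.mk.injEq]
  refine ⟨?_, funext fun i => ?_, ?_⟩
  · simp [toFamily_apply, hd']
  · simp [hσ.covDeriv_toFamily hg, toFamily_apply, hd']
  · simp [hσ.boxOp_toFamily hg, toFamily_apply]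
    ring

lemma IsScale.contract_scaleTractor {W : Type*} [AddCommGroup W] [Module ℂ W] (T : Slots d W) :
    contract g p (scaleTractor σ g p) T = gradPairing g (σ g) p T.mid + (σ g p : ℂ) • T.bot
      - (((scalarBox g (σ g) p + traceJ g p * σ g p) / d : ℂ)) • T.top := by
  rw [hσ.scaleTractor_eq hg p hd hc, contract, gradPairing_apply]
  module

lemma IsScale.scaleSq_eq :
    scaleSq σ g p = gradSq g (σ g) p
      - 2 / d * σ g p * (scalarBox g (σ g) p + traceJ g p * σ g p) := by
  have hmid : gradPairing g (σ g) p (fun i => (partialDeriv I (σ g) p i : ℂ))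
      = gradSq g (σ g) p := by
    simpa using gradPairing_partialDeriv_smul g (σ g) p (1 : ℂ)
  rw [scaleSq, hσ.contract_scaleTractor hg p hd hc, hσ.scaleTractor_eq hg p hd hc, hmid]
  simp only [smul_eq_mul]
  ring

end ScaleTractor

/-! ### The commutator with `log σ` -/

lemma commutator_yOp_logXOp (σ : RealFamily I M) (V : Family I M k) (g : PseudoMetric I M)
    (p : M) : commutator (yOp σ) (logXOp σ) V g p
      = -((scaleSq σ g p)⁻¹ • commutator (iDotD σ) (logXOp σ) V g p) := by
  simp only [commutator, Pi.sub_apply, logXOp, yOp, real_smul_eq_coe_smul]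
  module

lemma IsWeightedTractor.commutator_iDotD_logXOp (hd : d ≠ 0)
    {c : Set (PseudoMetric I M)} (hc : ∀ g ∈ c, ∀ s : ℝ, g.rescale (ContMDiffMap.const s) ∈ c)
    {σ : RealFamily I M} (hσ : IsScale c σ) {w : ℂ} {U : Set M} {f : Family I M k}
    (hf : IsWeightedTractor c w U f) {g : PseudoMetric I M} (hg : g ∈ c) {p : M} (hp : U ∈ 𝓝 p)
    (h0 : σ g p ≠ 0) :
    commutator (iDotD σ) (logXOp σ) f g p = scaleSq σ g p • xInvOp σ (hOp f - f) g p := by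
  have hd' : (d : ℂ) ≠ 0 := Nat.cast_ne_zero.2 hd
  have h0' : (σ g p : ℂ) ≠ 0 := Complex.ofReal_ne_zero.2 h0
  have hcov : covDeriv (logXOp σ f) g p = (Real.log (σ g p) : ℂ) • covDeriv f g p
      + (σ g p : ℂ)⁻¹ • fun i => (partialDeriv I (σ g) p i : ℂ) • f g p :=
    funext (hf.covDeriv_logXOp hσ hg hp h0)
  have hlog : logXOp σ (iDotD σ f) g p = (Real.log (σ g p) : ℂ) • iDotD σ f g p :=
    real_smul_eq_coe_smul _ _
  have hinv : xInvOp σ (hOp f - f) g p = (σ g p : ℂ)⁻¹ • ((d + 2 * w - 1) • f g p) := by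
    simp only [xInvOp, hOp, Pi.sub_apply, Pi.add_apply, Pi.smul_apply, real_smul_eq_coe_smul,
      hf.weightOp_apply hc hg (mem_of_mem_nhds hp), Complex.ofReal_inv]
    module
  simp only [commutator, Pi.sub_apply, hlog, hinv, iDotD, hσ.contract_scaleTractor hg p hd hc,
    hσ.scaleSq_eq hg p hd hc, hf.thomasD_eq hc hg hp, hf.thomasD_logXOp hc hσ hg hp h0, hcov,
    hf.boxOp_logXOp hσ hg hp h0, map_add, map_smul, gradPairing_partialDeriv_smul]
  match_scalars <;> field_simp <;> ring

end ConformalTractor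

end

theorem proposition6p1 {d : ℕ} (hd : 3 ≤ d)
    {H : Type*} [TopologicalSpace H] (I : ModelWithCorners ℝ (EuclideanSpace ℝ (Fin d)) H)
    {M : Type*} [TopologicalSpace M] [ChartedSpace H M] [IsManifold I ∞ M]
    (c : Set (ConformalTractor.PseudoMetric I M))
    (hc : ∃ g₀ : ConformalTractor.PseudoMetric I M, c = g₀.conformalClass)
    (σ : ConformalTractor.RealFamily I M) (hσ : ConformalTractor.IsScale c σ)
    (hI : ∀ g ∈ c, ∀ p : M, ConformalTractor.scaleSq σ g p ≠ 0)
    (U : Set M) (hU : IsOpen U) (hpos : ∀ g ∈ c, ∀ p ∈ U, 0 < σ g p)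
    (k : ℕ) (w : ℂ) (f : ConformalTractor.Family I M k)
    (hf : ConformalTractor.IsWeightedTractor c w U f) :
    ∀ g ∈ c, ∀ p ∈ U,
      ConformalTractor.commutator (ConformalTractor.yOp σ) (ConformalTractor.logXOp σ) f g p
        = -(ConformalTractor.xInvOp σ (ConformalTractor.hOp f - f)) g p := by
  obtain ⟨g₀, rfl⟩ := hc
  intro g hg p hp
  have hcomm := hf.commutator_iDotD_logXOp (by omega)
    (fun _ hg _ => ConformalTractor.PseudoMetric.rescale_mem_conformalClass hg _) hσ hg
    (hU.mem_nhds hp) (hpos g hg p hp).ne'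
  rw [ConformalTractor.commutator_yOp_logXOp, hcomm, inv_smul_smul₀ (hI g hg p)]
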